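/- **Theorem (Fehrele's principle).** Let $\mathbb{U}$ be a standard universe with set of atoms $X\subseteq\mathbb{U}$ (possibly empty): atoms have no elements in $\mathbb{U}$; every member of $\mathbb{U}$ that is not an atom is a subset of $\mathbb{U}$, and is called a *standard set*; $\emptyset$ is a standard set; and $\mathbb{U}$ is closed under unordered pairs $\{a,b\}$ and under unions (for every standard set $a$, the union of all non-atoms $b\in a$ is a standard set). For example, $\mathbb{U}$ may be the superstructure over a base set $X$, or a transitive model of enough of ZFC with $X=\emptyset$. Let ${}^{*}\mathbb{U}$ be an elementary extension of $(\mathbb{U},\in)$ in the first-order language of set theory which is sufficiently saturated, that is, $\kappa$-saturated for some cardinal $\kappa$ greater than the cardinality of every standard set: every set of formulas in one free variable with parameters from a set of fewer than $\kappa$ elements of ${}^{*}\mathbb{U}$ that is finitely satisfiable in ${}^{*}\mathbb{U}$ is satisfiable in ${}^{*}\mathbb{U}$. A subset of ${}^{*}\mathbb{U}$ is *internal* if it has the form $\{x\in{}^{*}\mathbb{U} : x\mathrel{{}^{*}{\in}}a\}$ for some $a\in{}^{*}\mathbb{U}$, where ${}^{*}{\in}$ is the membership relation of ${}^{*}\mathbb{U}$.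 A subset $G\subseteq{}^{*}\mathbb{U}$ is *galactic* if $G=\bigcup_{i\in S}G_i$ for some standard set $S$ and some family $(G_i)_{i\in S}$ of internal sets. A subset $H\subseteq{}^{*}\mathbb{U}$ is *halic* if $H=\bigcap_{i\in S}H_i$ for some standard set $S$ and some family $(H_i)_{i\in S}$ of internal sets (the intersection of the empty family being ${}^{*}\mathbb{U}$). The families themselves need not be internal. Then every subset of ${}^{*}\mathbb{U}$ that is both galactic and halic is internal. -/

import Mathlib

open FirstOrder Cardinal

universe u v

namespace Nonstandard

/-- The only symbol of the language of set theory: the binary relation of membership. -/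
inductive SetRel : ℕ → Type
  | mem : SetRel 2

/-- The first-order language `{∈}` of set theory. -/
def setLanguage : FirstOrder.Language.{0, 0} where
  Functions := fun _ => Empty
  Relations := SetRel

/-- The membership symbol, as a binary relation symbol of the language of set theory. -/
def memSymbol : setLanguage.Relations 2 := SetRel.mem

/-- The membership relation `x ∈ a` of a structure for the language of set theory. -/
def Mem {M : Type v} [setLanguage.Structure M] (x a : M) : Prop :=
  Language.Structure.RelMap memSymbol ![x, a]

/-- `U` is a standard universe with set of atoms `X`. Atoms have no elements in `U`, and every
member of `U` which is not an atom is a set of members of `U`. Of the closure properties of a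
universe, only the empty set, unordered pairs and unions are required.
The superstructure over a base set `X` (`∅ ∉ X`, and no member of `X` has an element in the
superstructure) is a standard universe with atoms `X`; transitive models
of (enough of) ZFC, the stages `V_α` for limit `α > 0`, and Grothendieck universes that contain
the empty set are standard universes with `X = ∅`. -/
structure IsStandardUniverse (X U : ZFSet.{u}) : Prop where
  atoms_subset : X ⊆ U
  atoms_empty : ∀ x ∈ X, ∀ y ∈ U, y ∉ x
  transitive : ∀ a ∈ U, a ∉ X → a ⊆ U
  empty_mem : ∅ ∈ U
  empty_not_atom : ∅ ∉ X
  pair_mem : ∀ a ∈ U, ∀ b ∈ U, ({a, b} : ZFSet.{u}) ∈ U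
  union_mem : ∀ a ∈ U, a ∉ X → ∃ c ∈ U, c ∉ X ∧ ∀ z, z ∈ c ↔ ∃ b ∈ a, b ∉ X ∧ z ∈ b

/-- `S` is a standard set: a member of the standard universe `U` that is not an atom. -/
abbrev IsStandardSet (X U S : ZFSet.{u}) : Prop := S ∈ U ∧ S ∉ X

/-- The type of members of `U`. -/
abbrev Carrier (U : ZFSet.{u}) : Type (u + 1) := {x : ZFSet.{u} // x ∈ U}

/-- The structure `(U, ∈)`, with the true membership relation. -/
instance (U : ZFSet.{u}) : setLanguage.Structure (Carrier U) where
  funMap := fun f _ => f.elim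
  RelMap := fun r => match r with
    | SetRel.mem => fun w => (w 0).1 ∈ (w 1).1

/-- `M` is `κ`-saturated: every set of formulas in one variable, with parameters from a set of
fewer than `κ` elements, which is finitely satisfiable in `M` is satisfiable in `M`. -/
def IsSaturated (κ : Cardinal.{v}) (M : Type v) [setLanguage.Structure M] : Prop :=
  ∀ C : Set M, #C < κ → ∀ p : Set (setLanguage.Formula (C ⊕ Unit)),
    (∀ q : Set (setLanguage.Formula (C ⊕ Unit)), q ⊆ p → q.Finite →
      ∃ x : M, ∀ φ ∈ q, φ.Realize (Sum.elim (fun c : C => (c : M)) (fun _ => x))) →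
    ∃ x : M, ∀ φ ∈ p, φ.Realize (Sum.elim (fun c : C => (c : M)) (fun _ => x))

/-- A subset of `M` is internal if it is the set of all elements, in the sense of `M`, of some
member of `M`. -/
def IsInternal {M : Type v} [setLanguage.Structure M] (A : Set M) : Prop :=
  ∃ a : M, A = {x | Mem x a}

/-- A set is galactic if it is the union of a family of internal sets indexed by a standard set.
The family itself need not be internal. -/
def IsGalactic (X U : ZFSet.{u}) {M : Type v} [setLanguage.Structure M] (G : Set M) : Prop :=
  ∃ S : ZFSet.{u}, IsStandardSet X U S ∧
    ∃ F : {i : ZFSet.{u} // i ∈ S} → Set M, (∀ i, IsInternal (F i)) ∧ G = ⋃ i, F i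

/-- A set is halic if it is the intersection of a family of internal sets indexed by a standard
set. The family itself need not be internal. -/
def IsHalic (X U : ZFSet.{u}) {M : Type v} [setLanguage.Structure M] (H : Set M) : Prop :=
  ∃ S : ZFSet.{u}, IsStandardSet X U S ∧
    ∃ F : {i : ZFSet.{u} // i ∈ S} → Set M, (∀ i, IsInternal (F i)) ∧ H = ⋂ i, F i

end Nonstandard

namespace Nonstandard

open FirstOrder.Language

/-! Write the set as `A = ⋃ G_i = ⋂ H_j`. An internal set containing every `G_i` and contained in
every `H_j` lies between the union and the intersection, so it equals `A`. These inclusions are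
formulas in one variable with codes of the `G_i` and `H_j` as parameters. Finitely many are
satisfiable: a finite union of sets `G_i` is internal, by transfer of the empty set and binary
unions, and lies in `A`, hence in every `H_j`. Saturation then gives the internal set
(`IsSaturated.exists_interpolant`). That there are fewer than `κ` parameters in total uses that `κ`
is infinite (`IsStandardUniverse.aleph0_le`). -/

/-- The atomic formula `s ∈ t`. -/
def memFormula {α : Type*} {n : ℕ} (s t : setLanguage.Term (α ⊕ Fin n)) :
    setLanguage.BoundedFormula α n :=
  memSymbol.boundedFormula₂ s t

theorem realize_memFormula {M : Type v} [setLanguage.Structure M] {α : Type*} {n : ℕ}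
    (s t : setLanguage.Term (α ⊕ Fin n)) (w : α → M) (xs : Fin n → M) :
    (memFormula s t).Realize w xs ↔
      Mem (s.realize (Sum.elim w xs)) (t.realize (Sum.elim w xs)) :=
  BoundedFormula.realize_rel₂

/-- The formula `∀ z, z ∈ a → z ∈ b`, for free variables `a` and `b`. -/
def inclusionFormula {α : Type*} (a b : α) : setLanguage.Formula α :=
  BoundedFormula.all (n := 0)
    ((memFormula (Term.var (Sum.inr 0)) (Term.var (Sum.inl a))).imp
      (memFormula (Term.var (Sum.inr 0)) (Term.var (Sum.inl b))))

theorem realize_inclusionFormula {M : Type v} [setLanguage.Structure M] {α : Type*}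
    (a b : α) (w : α → M) :
    (inclusionFormula a b).Realize w ↔ ∀ z : M, Mem z (w a) → Mem z (w b) := by
  simp [inclusionFormula, Formula.Realize, realize_memFormula, Fin.snoc]

/-- The sentence `∃ c, ∀ z, z ∉ c`. -/
def emptySentence : setLanguage.Sentence :=
  BoundedFormula.ex (n := 0) (BoundedFormula.all (n := 1)
    (memFormula (Term.var (Sum.inr 1)) (Term.var (Sum.inr 0))).not)

theorem realize_emptySentence (M : Type v) [setLanguage.Structure M] :
    M ⊨ emptySentence ↔ ∃ c : M, ∀ z : M, ¬ Mem z c := by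
  simp [emptySentence, Sentence.Realize, Formula.Realize, realize_memFormula, Fin.snoc]

/-- The sentence `∀ a b, ∃ c, ∀ z, z ∈ c ↔ z ∈ a ∨ z ∈ b`. -/
def unionSentence : setLanguage.Sentence :=
  BoundedFormula.all (n := 0) (BoundedFormula.all (n := 1) (BoundedFormula.ex (n := 2)
    (BoundedFormula.all (n := 3)
      ((memFormula (Term.var (Sum.inr 3)) (Term.var (Sum.inr 2))).iff
        (memFormula (Term.var (Sum.inr 3)) (Term.var (Sum.inr 0)) ⊔
          memFormula (Term.var (Sum.inr 3)) (Term.var (Sum.inr 1)))))))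

theorem realize_unionSentence (M : Type v) [setLanguage.Structure M] :
    M ⊨ unionSentence ↔ ∀ a b : M, ∃ c : M, ∀ z : M, Mem z c ↔ Mem z a ∨ Mem z b := by
  simp [unionSentence, Sentence.Realize, Formula.Realize, realize_memFormula, Fin.snoc]

theorem mem_carrier_iff {U : ZFSet.{u}} (x a : Carrier U) : Mem x a ↔ x.1 ∈ a.1 := Iff.rfl

namespace IsStandardUniverse

variable {X U : ZFSet.{u}}

theorem pair_not_atom (hU : IsStandardUniverse X U) {a : ZFSet.{u}} (ha : a ∈ U)
    (b : ZFSet.{u}) : ({a, b} : ZFSet.{u}) ∉ X :=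
  fun h => hU.atoms_empty _ h a ha (by simp)

theorem realize_emptySentence (hU : IsStandardUniverse X U) : Carrier U ⊨ emptySentence :=
  (Nonstandard.realize_emptySentence _).2
    ⟨⟨∅, hU.empty_mem⟩, fun z => by simp [mem_carrier_iff]⟩

theorem exists_union (hU : IsStandardUniverse X U) {a b : ZFSet.{u}} (ha : a ∈ U) (hb : b ∈ U) :
    ∃ c ∈ U, c ∉ X ∧ ∀ z ∈ U, z ∈ c ↔ z ∈ a ∨ z ∈ b := by
  obtain ⟨c, hc, hcX, h⟩ := hU.union_mem _ (hU.pair_mem a ha b hb) (hU.pair_not_atom ha b)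
  refine ⟨c, hc, hcX, fun z hz => (h z).trans ?_⟩
  -- The union axiom collects elements of non-atoms only. This loses nothing, since anything with an
  -- element in `U` is not an atom; so `a` and `b` themselves may be atoms.
  have key : ∀ d, z ∈ d → d ∉ X := fun d hd hdX => hU.atoms_empty d hdX z hz hd
  simp only [ZFSet.mem_pair]
  grind

theorem realize_unionSentence (hU : IsStandardUniverse X U) : Carrier U ⊨ unionSentence := by
  rw [Nonstandard.realize_unionSentence]
  rintro ⟨a, ha⟩ ⟨b, hb⟩
  obtain ⟨c, hc, -, h⟩ := hU.exists_union ha hb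
  exact ⟨⟨c, hc⟩, fun z => h z.1 z.2⟩

/-- A standard universe has standard sets of every finite cardinality. -/
theorem exists_standardSet_card_eq (hU : IsStandardUniverse X U) (n : ℕ) :
    ∃ S : ZFSet.{u}, IsStandardSet X U S ∧ #{i : ZFSet.{u} // i ∈ S} = n := by
  induction n with
  | zero => exact ⟨∅, ⟨hU.empty_mem, hU.empty_not_atom⟩, by simp⟩
  | succ n ih =>
    obtain ⟨S, ⟨hS, hSX⟩, hn⟩ := ih
    -- The von Neumann successor `S ∪ {S}`; it has exactly one more element because `S ∉ S` by
    -- foundation.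
    obtain ⟨c, hc, hcX, h⟩ := hU.exists_union hS (hU.pair_mem S hS S hS)
    refine ⟨c, ⟨hc, hcX⟩, ?_⟩
    have hset : {i | i ∈ c} = insert S {i | i ∈ S} := by
      ext z
      simp only [Set.mem_ofPred_eq, Set.mem_insert_iff]
      constructor
      · intro hz
        have := (h z (hU.transitive c hc hcX hz)).1 hz
        simp only [ZFSet.mem_pair] at this
        tauto
      · rintro (rfl | hz)
        · exact (h z hS).2 (by simp)
        · exact (h z (hU.transitive S hS hSX hz)).2 (Or.inl hz)
    have hcard := Cardinal.mk_insert (s := {i | i ∈ S}) (a := S) (ZFSet.mem_irrefl S)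
    rw [← hset] at hcard
    have hn' : #({i | i ∈ S} : Set ZFSet.{u}) = n := hn
    rw [hn'] at hcard
    exact_mod_cast hcard

/-- A cardinal that exceeds the cardinality of every standard set is infinite. -/
theorem aleph0_le (hU : IsStandardUniverse X U) {κ : Cardinal.{v}}
    (hκ : ∀ S : ZFSet.{u}, IsStandardSet X U S →
      Cardinal.lift.{v} #{i : ZFSet.{u} // i ∈ S} < Cardinal.lift.{u + 1} κ) : ℵ₀ ≤ κ := by
  by_contra! h
  obtain ⟨n, rfl⟩ := Cardinal.lt_aleph0.1 h
  obtain ⟨S, hS, hn⟩ := hU.exists_standardSet_card_eq n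
  have := hκ S hS
  simp [hn] at this

end IsStandardUniverse

/-- Finitely many internal subsets of a set have an internal upper bound that is still a subset
of it. -/
theorem exists_upper_bound_of_finite {M : Type v} [setLanguage.Structure M]
    (h₀ : M ⊨ emptySentence) (h₁ : M ⊨ unionSentence) {A : Set M} {s : Set M} (hs : s.Finite)
    (hsA : ∀ a ∈ s, {x | Mem x a} ⊆ A) :
    ∃ c : M, {x | Mem x c} ⊆ A ∧ ∀ a ∈ s, ∀ z, Mem z a → Mem z c := by
  induction s, hs using Set.Finite.induction_on with
  | empty =>
    obtain ⟨c, hc⟩ := (realize_emptySentence M).1 h₀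
    exact ⟨c, fun x hx => absurd hx (hc x), by simp⟩
  | @insert a s _ _ ih =>
    obtain ⟨c, hcA, hc⟩ := ih fun b hb => hsA b (Set.mem_insert_of_mem a hb)
    obtain ⟨d, hd⟩ := (realize_unionSentence M).1 h₁ a c
    refine ⟨d, fun x hx => ?_, ?_⟩
    · rcases (hd x).1 hx with hx | hx
      · exact hsA a (Set.mem_insert a s) hx
      · exact hcA hx
    · rintro b (rfl | hb) z hz
      · exact (hd z).2 (Or.inl hz)
      · exact (hd z).2 (Or.inr (hc b hb z hz))

/-- In a saturated structure, an internal set can be interpolated between two small families of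
internal sets which are separated by some set. -/
theorem IsSaturated.exists_interpolant {M : Type v} [setLanguage.Structure M] {κ : Cardinal.{v}}
    (hM : IsSaturated κ M) (h₀ : M ⊨ emptySentence) (h₁ : M ⊨ unionSentence) {A G H : Set M}
    (hcard : #(G ∪ H : Set M) < κ)
    (hG : ∀ g ∈ G, {x | Mem x g} ⊆ A) (hH : ∀ h ∈ H, A ⊆ {x | Mem x h}) :
    ∃ c : M, (∀ g ∈ G, {x | Mem x g} ⊆ {x | Mem x c}) ∧
      ∀ h ∈ H, {x | Mem x c} ⊆ {x | Mem x h} := by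
  let lower (g : (G ∪ H : Set M)) : setLanguage.Formula ((G ∪ H : Set M) ⊕ Unit) :=
    inclusionFormula (Sum.inl g) (Sum.inr ())
  let upper (h : (G ∪ H : Set M)) : setLanguage.Formula ((G ∪ H : Set M) ⊕ Unit) :=
    inclusionFormula (Sum.inr ()) (Sum.inl h)
  obtain ⟨c, hc⟩ := hM (G ∪ H) hcard (lower '' {g | g.1 ∈ G} ∪ upper '' {h | h.1 ∈ H}) (by
    intro q hq hfin
    -- Only the lower conditions in `q` need finiteness: a bound for them that stays inside `A`
    -- meets all upper conditions at once.
    obtain ⟨t, htG, htfin, ht⟩ := Set.exists_subset_image_finite_and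
      (p := fun r => q ∩ lower '' {g | g.1 ∈ G} = r) |>.1
      ⟨_, Set.inter_subset_right, hfin.inter_of_left _, rfl⟩
    obtain ⟨c, hcA, hc⟩ := exists_upper_bound_of_finite h₀ h₁ (htfin.image Subtype.val)
      (A := A) (by rintro _ ⟨g, hg, rfl⟩; exact hG _ (htG hg))
    refine ⟨c, fun φ hφ => ?_⟩
    rcases hq hφ with h | ⟨h, hh, rfl⟩
    · have hmem : φ ∈ lower '' t := ht ▸ ⟨hφ, h⟩
      obtain ⟨g, hg, rfl⟩ := hmem
      exact (realize_inclusionFormula _ _ _).2 (hc g.1 ⟨g, hg, rfl⟩)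
    · exact (realize_inclusionFormula _ _ _).2 fun z hz => hH _ hh (hcA hz))
  refine ⟨c, fun g hg => ?_, fun h hh => ?_⟩
  · exact (realize_inclusionFormula _ _ _).1 (hc _ (Or.inl ⟨⟨g, Or.inl hg⟩, hg, rfl⟩))
  · exact (realize_inclusionFormula _ _ _).1 (hc _ (Or.inr ⟨⟨h, Or.inr hh⟩, hh, rfl⟩))

end Nonstandard

theorem mainTheorem1 (X U : ZFSet.{u}) (hU : Nonstandard.IsStandardUniverse X U)
    (M : Type v) [Nonstandard.setLanguage.Structure M]
    (j : FirstOrder.Language.ElementaryEmbedding Nonstandard.setLanguage (Nonstandard.Carrier U) M)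
    (κ : Cardinal.{v})
    (hκ : ∀ S : ZFSet.{u}, Nonstandard.IsStandardSet X U S →
      Cardinal.lift.{v} #{i : ZFSet.{u} // i ∈ S} < Cardinal.lift.{u + 1} κ)
    (hM : Nonstandard.IsSaturated κ M)
    (A : Set M) (hG : Nonstandard.IsGalactic X U A) (hH : Nonstandard.IsHalic X U A) :
    Nonstandard.IsInternal A := by
  obtain ⟨S, hS, F, hF, hAF⟩ := hG
  obtain ⟨T, hT, K, hK, hAK⟩ := hH
  choose g hg using hF
  choose k hk using hK
  have small : ∀ R : ZFSet.{u}, Nonstandard.IsStandardSet X U R →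
      ∀ f : {i : ZFSet.{u} // i ∈ R} → M, #(Set.range f) < κ := fun R hR f =>
    Cardinal.lift_lt.1 (Cardinal.mk_range_le_lift.trans_lt (hκ R hR))
  -- Each family of codes has fewer than `κ` members; for an infinite `κ` the sum of two smaller
  -- cardinals is still below `κ`.
  have hcard : #(Set.range g ∪ Set.range k : Set M) < κ :=
    (Cardinal.mk_union_le _ _).trans_lt
      (Cardinal.add_lt_of_lt (hU.aleph0_le hκ) (small S hS g) (small T hT k))
  obtain ⟨c, hc₁, hc₂⟩ := hM.exists_interpolant
    ((j.map_sentence _).1 hU.realize_emptySentence)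
    ((j.map_sentence _).1 hU.realize_unionSentence) (A := A) hcard
    (by rintro _ ⟨i, rfl⟩; rw [← hg i, hAF]; exact Set.subset_iUnion F i)
    (by rintro _ ⟨i, rfl⟩; rw [← hk i, hAK]; exact Set.iInter_subset K i)
  -- The galactic form of `A` gives the lower inclusion, the halic form the upper one.
  refine ⟨c, Set.Subset.antisymm ?_ ?_⟩
  · rw [hAF]
    exact Set.iUnion_subset fun i => hg i ▸ hc₁ _ ⟨i, rfl⟩
  · rw [hAK]
    exact Set.subset_iInter fun i => hk i ▸ hc₂ _ ⟨i, rfl⟩
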